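/- Let $R$ be a commutative ring with $1$. Call $R$ *indecomposable* if $0 \neq 1$ in $R$ and the only idempotents of $R$ are $0$ and $1$. For a commutative unital $R$-algebra $S$, the set $\mathrm{Id}(S)$ of idempotents of $S$ is a Boolean algebra under $e\vee f=e+f-ef$, $e\wedge f=ef$, $\neg e=1-e$. Call $S$ a *Specker $R$-algebra* if there is a Boolean subalgebra $B$ of $\mathrm{Id}(S)$ that generates $S$ as an $R$-algebra and in which each nonzero $e\in B$ is faithful, i.e. $ae=0$ with $a\in R$ implies $a=0$. Let $\mathbf{Sp}_R$ be the category of Specker $R$-algebras and unital $R$-algebra homomorphisms, and let $\mathbf{Stone}$ be the category of Stone spaces (zero-dimensional compact Hausdorff spaces) and continuous maps. If $R$ is indecomposable, then $\mathbf{Sp}_R$ is dually equivalent to $\mathbf{Stone}$; that is, there is an equivalence of categories between $\mathbf{Sp}_R^{\mathrm{op}}$ and $\mathbf{Stone}$. -/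

import Mathlib

open CategoryTheory

universe u v

/-- A commutative ring is indecomposable if it is nonzero and its only idempotents are `0` and `1`
(that is, its Boolean algebra of idempotents has exactly the two elements `0` and `1`). -/
structure IsIndecomposableRing (R : Type*) [CommRing R] : Prop where
  zero_ne_one : (0 : R) ≠ 1
  eq_zero_or_one : ∀ e : R, IsIdempotentElem e → e = 0 ∨ e = 1

/-- The set of idempotents of a commutative ring. Mathlib makes it a Boolean algebra with
`e ⊔ f = e + f - e * f`, `e ⊓ f = e * f`, `eᶜ = 1 - e`, `⊥ = 0`, `⊤ = 1`. -/
abbrev Idempotents (S : Type*) [CommRing S] : Type _ := {e : S // IsIdempotentElem e}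

/-- A Boolean subalgebra `B` of the idempotents of an `R`-algebra `S` is a faithful generating
algebra of idempotents if it generates `S` as an `R`-algebra and each nonzero `e ∈ B` is faithful:
`a • e = 0` with `a : R` forces `a = 0`. -/
structure IsFaithfulGenerating (R : Type*) {S : Type*} [CommRing R] [CommRing S] [Algebra R S]
    (B : BooleanSubalgebra (Idempotents S)) : Prop where
  generates : Algebra.adjoin R ((fun e : Idempotents S => (e : S)) '' (B : Set (Idempotents S))) = ⊤
  faithful : ∀ e ∈ B, (e : S) ≠ 0 → ∀ a : R, a • (e : S) = 0 → a = 0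

/-- A Specker `R`-algebra: a commutative `R`-algebra with a faithful generating algebra of
idempotents. -/
def IsSpeckerAlgebra (R S : Type*) [CommRing R] [CommRing S] [Algebra R S] : Prop :=
  ∃ B : BooleanSubalgebra (Idempotents S), IsFaithfulGenerating R B

/-- The category of Specker `R`-algebras: the full subcategory of commutative `R`-algebras (with
unital `R`-algebra homomorphisms) on the Specker `R`-algebras. -/
abbrev SpeckerAlgCat (R : Type u) [CommRing R] :=
  ObjectProperty.FullSubcategory (fun S : CommAlgCat.{v} R => IsSpeckerAlgebra R S)

/-- The category of Stone spaces: compact Hausdorff spaces that are zero-dimensional (the clopen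
sets form a basis of the topology), with continuous maps. -/
abbrev StoneSpaceCat :=
  CompHausLike.{v} (fun X => TopologicalSpace.IsTopologicalBasis {U : Set X | IsClopen U})

/-- Two categories are dually equivalent if the opposite of the first one is equivalent to the
second one. -/
def DuallyEquivalent (C : Type*) [Category C] (D : Type*) [Category D] : Prop :=
  Nonempty (Cᵒᵖ ≌ D)

/-!
A Stone space `X` is sent to the algebra `LocallyConstant X R`; this contravariant functor is shown
to be full, faithful and essentially surjective.

When `R` is indecomposable, the idempotents of `LocallyConstant X R` are exactly the characteristic
functions of the clopen sets, so the algebra is Specker. For the same reason an algebra homomorphism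
`LocallyConstant X R → R` sends characteristic functions to `0` or `1`, and therefore picks out an
ultrafilter of clopen sets; by compactness it is evaluation at a point
(`IsIndecomposableRing.exists_eq_eval`). Hence every homomorphism between two such algebras is
composition with a continuous map, which gives fullness, and faithfulness holds because clopen sets
separate points.

Essential surjectivity (`IsSpeckerAlgebra.exists_algEquiv_locallyConstant`) holds over any `R`. Let
`B` be a faithful generating algebra of idempotents of `S`, and let `X` be the prime spectrum of `B`
viewed as a Boolean ring, that is, its Stone space. The elements of a prime ideal `x` of `B` generate
an ideal of `S`. Modulo it every element of `B` becomes `0` or `1`, so the quotient is a quotient of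
`R`, and faithfulness makes it `R` itself. The resulting characters `S → R`, one for each `x`,
assemble into an isomorphism from `S` to `LocallyConstant X R`: it is injective because the elements
of `B` annihilating a nonzero `s` lie in a maximal ideal, at which `s` does not vanish, and
surjective because every clopen subset of `X` comes from an element of `B`.
-/

/-! ### Locally constant functions on a Stone space -/

section LocallyConstant

variable {R : Type*} [CommRing R] {X : Type*} [TopologicalSpace X]

namespace LocallyConstant

lemma isIdempotentElem_charFn {U : Set X} (hU : IsClopen U) :
    IsIdempotentElem (charFn R hU) := by
  ext x
  by_cases hx : x ∈ U <;> simp [coe_charFn, hx]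

lemma one_sub_charFn {U : Set X} (hU : IsClopen U) :
    1 - charFn R hU = charFn R hU.compl := by
  ext x
  by_cases hx : x ∈ U <;> simp [sub_apply, coe_charFn, hx]

lemma charFn_mul_charFn {U V : Set X} (hU : IsClopen U) (hV : IsClopen V) :
    charFn R hU * charFn R hV = charFn R (hU.inter hV) := by
  ext x
  by_cases hx : x ∈ U <;> by_cases hx' : x ∈ V <;> simp [coe_charFn, hx, hx']

lemma charFn_fiber_mul_self (f : LocallyConstant X R) (r : R) :
    charFn R (f.isLocallyConstant.isClopen_fiber r) * f =
      r • charFn R (f.isLocallyConstant.isClopen_fiber r) := by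
  ext x
  by_cases hx : f x = r <;> simp [coe_charFn, hx]

/-- A locally constant function on a compact space takes finitely many values, so it is a linear
combination of the characteristic functions of its fibres. -/
lemma mem_of_charFn_mem [CompactSpace X] (T : Subalgebra R (LocallyConstant X R))
    (hT : ∀ (U : Set X) (hU : IsClopen U), charFn R hU ∈ T) (f : LocallyConstant X R) :
    f ∈ T := by
  have hfin := f.range_finite
  have key : f = ∑ r ∈ hfin.toFinset, r • charFn R (f.isLocallyConstant.isClopen_fiber r) := by
    ext x
    have hev := map_sum (evalₗ (Y := R) R x)
      (fun r ↦ r • charFn R (f.isLocallyConstant.isClopen_fiber r)) hfin.toFinset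
    simp only [evalₗ_apply] at hev
    rw [hev, Finset.sum_eq_single (f x)]
    · simp [coe_charFn]
    · intro r _ hr
      simp [coe_charFn, Ne.symm hr]
    · simp
  rw [key]
  exact sum_mem fun r _ ↦ T.smul_mem (hT _ _) r

end LocallyConstant

open LocallyConstant

namespace IsIndecomposableRing

lemma nontrivial (hR : IsIndecomposableRing R) : Nontrivial R :=
  ⟨⟨0, 1, hR.zero_ne_one⟩⟩

/-- Over an indecomposable ring the idempotents of the algebra of locally constant functions are
`0`-`1`-valued, hence the nonzero ones are faithful, and they generate. -/
lemma isSpeckerAlgebra_locallyConstant (hR : IsIndecomposableRing R) [CompactSpace X] :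
    IsSpeckerAlgebra R (LocallyConstant X R) := by
  refine ⟨⊤, ?_, ?_⟩
  · refine Algebra.eq_top_iff.2 fun f ↦ mem_of_charFn_mem _ (fun U hU ↦ ?_) f
    exact Algebra.subset_adjoin ⟨⟨_, isIdempotentElem_charFn hU⟩, by simp, rfl⟩
  · rintro ⟨e, he⟩ - hne a ha
    obtain ⟨x, hx⟩ : ∃ x, e x ≠ 0 := by
      by_contra! h
      exact hne (LocallyConstant.ext h)
    have hex : e x = 1 := (hR.eq_zero_or_one (e x) (congr($he x))).resolve_left hx
    simpa [hex] using congr($ha x)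

/-- Over an indecomposable ring, every character of the algebra of locally constant functions on a
compact space is the evaluation at a point: the clopen sets on whose characteristic functions the
character takes the value `1` form an ultrafilter of clopen sets, which has a common point. -/
lemma exists_eq_eval (hR : IsIndecomposableRing R) [CompactSpace X]
    (ψ : LocallyConstant X R →ₐ[R] R) : ∃ x : X, ∀ f, ψ f = f x := by
  have := hR.nontrivial
  have h01 {U : Set X} (hU : IsClopen U) : ψ (charFn R hU) = 0 ∨ ψ (charFn R hU) = 1 :=
    hR.eq_zero_or_one _ ((isIdempotentElem_charFn hU).map ψ)
  let 𝒰 := {U : Set X // ∃ hU : IsClopen U, ψ (charFn R hU) = 1}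
  have hdir : Directed (· ⊇ ·) (Subtype.val : 𝒰 → Set X) := by
    rintro ⟨U, hU, hU1⟩ ⟨V, hV, hV1⟩
    refine ⟨⟨U ∩ V, hU.inter hV, ?_⟩, Set.inter_subset_left, Set.inter_subset_right⟩
    rw [← charFn_mul_charFn hU hV, map_mul, hU1, hV1, one_mul]
  have huniv : ψ (charFn R (isClopen_univ (X := X))) = 1 := by
    rw [← map_one ψ]
    congr 1
    ext x
    simp [coe_charFn]
  have : Nonempty 𝒰 := ⟨⟨Set.univ, isClopen_univ, huniv⟩⟩
  obtain ⟨x, hx⟩ := IsCompact.nonempty_iInter_of_directed_nonempty_isCompact_isClosed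
    (Subtype.val : 𝒰 → Set X) hdir
    (by
      rintro ⟨U, hU, hU1⟩
      by_contra hne
      rw [Set.not_nonempty_iff_eq_empty] at hne
      have h0 : charFn R hU = 0 := by
        ext y
        have hy : y ∉ U := by
          change U = ∅ at hne
          simp [hne]
        simp [coe_charFn, hy]
      rw [h0, map_zero] at hU1
      exact hR.zero_ne_one hU1)
    (fun U ↦ U.2.choose.isClosed.isCompact) (fun U ↦ U.2.choose.isClosed)
  have hmem {U : Set X} (hU : IsClopen U) (h : ψ (charFn R hU) = 1) : x ∈ U :=
    Set.mem_iInter.1 hx ⟨U, hU, h⟩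
  refine ⟨x, fun f ↦ ?_⟩
  have hfib : ψ (charFn R (f.isLocallyConstant.isClopen_fiber (f x))) = 1 := by
    refine (h01 _).resolve_left fun h0 ↦ ?_
    -- Otherwise the complement of the fibre through `x` would contain `x`.
    have hf := f.isLocallyConstant.isClopen_fiber (f x)
    refine absurd rfl (hmem hf.compl ?_)
    rw [← one_sub_charFn hf, map_sub, h0, map_one, sub_zero]
  simpa [hfib] using congr(ψ $(charFn_fiber_mul_self f (f x)))

end IsIndecomposableRing

section Comap

variable {Y : Type*} [TopologicalSpace Y]

lemma LocallyConstant.eq_of_forall_apply_eq [Nontrivial R] [T2Space X]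
    (hX : TopologicalSpace.IsTopologicalBasis {U : Set X | IsClopen U}) {x y : X}
    (h : ∀ f : LocallyConstant X R, f x = f y) : x = y := by
  by_contra hne
  obtain ⟨U, hU, hxU, hUy⟩ :=
    hX.exists_subset_of_mem_open (show x ∈ ({y}ᶜ : Set X) from hne) isOpen_compl_singleton
  have hy : y ∉ U := fun hy ↦ hUy hy rfl
  have h1 := h (charFn R hU)
  rw [(charFn_eq_one R x hU).2 hxU, (charFn_eq_zero R y hU).2 hy] at h1
  exact one_ne_zero h1

/-- Composing with the evaluations of `LocallyConstant X R` turns `φ` into a family of characters of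
`LocallyConstant Y R`, hence into a family of points of `Y`. -/
lemma IsIndecomposableRing.exists_eq_comap (hR : IsIndecomposableRing R) [CompactSpace Y]
    (hY : TopologicalSpace.IsTopologicalBasis {U : Set Y | IsClopen U})
    (φ : LocallyConstant Y R →ₐ[R] LocallyConstant X R) :
    ∃ g : C(X, Y), φ = comapₐ R g := by
  have := hR.nontrivial
  choose g hg using fun x : X ↦ hR.exists_eq_eval ((evalₐ R x).comp φ)
  replace hg (x : X) (f : LocallyConstant Y R) : φ f x = f (g x) := hg x f
  have hcont : Continuous g := by
    refine hY.continuous_iff.2 fun U hU ↦ ?_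
    have : g ⁻¹' U = φ (charFn R hU) ⁻¹' {1} := by
      ext x
      simp [hg, charFn_eq_one]
    rw [this]
    exact (φ (charFn R hU)).isLocallyConstant _
  refine ⟨⟨g, hcont⟩, ?_⟩
  ext f x
  exact hg x f

end Comap

end LocallyConstant

/-! ### Representing a Specker algebra by locally constant functions -/

namespace SpeckerRepresentation

section

variable {R : Type*} [CommRing R] {A : Type*} [BooleanRing A] {S : Type*} [CommRing S]
  [Algebra R S]

/-- A multiplicative map `ι` from a Boolean ring `A` to an `R`-algebra `S` exhibits `A` as a
faithful generating algebra of idempotents of `S`. Only products and complements are respected: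
the sum of `A` is the symmetric difference, which in general differs from the sum of `S`. -/
structure IsFaithfulGeneratingHom (R : Type*) [CommRing R] [Algebra R S] (ι : A →*₀ S) :
    Prop where
  map_one_add : ∀ a, ι (1 + a) = 1 - ι a
  eq_zero_of_map : ∀ a, ι a = 0 → a = 0
  faithful : ∀ a, ι a ≠ 0 → ∀ r : R, r • ι a = 0 → r = 0
  generates : Algebra.adjoin R (Set.range ι) = ⊤

variable {ι : A →*₀ S} (hι : IsFaithfulGeneratingHom R ι)

/-- The ring expression `a + b + a * b` is the join of `a` and `b`. -/
lemma IsFaithfulGeneratingHom.map_join (hι : IsFaithfulGeneratingHom R ι) (a b : A) :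
    1 - ι (a + b + a * b) = (1 - ι a) * (1 - ι b) := by
  rw [← hι.map_one_add, ← hι.map_one_add, ← hι.map_one_add, ← map_mul]
  congr 1
  ring

/-- The ideal of `S` generated by the images of the elements of a prime ideal `x` of the Boolean
ring `A`. It is described as the set of elements absorbed by the image of some element of `x`. -/
def idealAt (x : PrimeSpectrum A) : Ideal S where
  carrier := {s | ∃ a ∈ x.asIdeal, s * (1 - ι a) = 0}
  zero_mem' := ⟨0, x.asIdeal.zero_mem, zero_mul _⟩
  add_mem' := by
    rintro s t ⟨a, ha, hs⟩ ⟨b, hb, ht⟩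
    refine ⟨a + b + a * b, add_mem (add_mem ha hb) (Ideal.mul_mem_right _ _ ha), ?_⟩
    rw [hι.map_join]
    linear_combination (1 - ι b) * hs + (1 - ι a) * ht
  smul_mem' := by
    rintro c s ⟨a, ha, hs⟩
    exact ⟨a, ha, by rw [smul_eq_mul, mul_assoc, hs, mul_zero]⟩

lemma map_mem_idealAt {x : PrimeSpectrum A} {a : A} (ha : a ∈ x.asIdeal) :
    ι a ∈ idealAt hι x :=
  ⟨a, ha, by rw [← hι.map_one_add, ← map_mul, BooleanRing.mul_one_add_self, map_zero]⟩

/-- Modulo the ideal at a prime `x`, each generator becomes `0` or `1`, so `R` surjects onto the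
quotient; faithfulness of the nonzero idempotents makes this surjection injective. -/
lemma bijective_algebraMap_quotient (x : PrimeSpectrum A) :
    Function.Bijective (Algebra.ofId R (S ⧸ idealAt hι x)) := by
  constructor
  · refine (injective_iff_map_eq_zero _).2 fun r hr ↦ ?_
    obtain ⟨a, ha, h⟩ : algebraMap R S r ∈ idealAt hι x :=
      Ideal.Quotient.eq_zero_iff_mem.1 hr
    refine hι.faithful (1 + a) (fun h0 ↦ x.2.ne_top ?_) r
      (by rw [Algebra.smul_def, hι.map_one_add, h])
    rw [Ideal.eq_top_iff_one]
    have h1 : (1 : A) = a := (BooleanRing.add_eq_zero' _ _).1 (hι.eq_zero_of_map _ h0)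
    rwa [h1]
  · rw [← AlgHom.range_eq_top, eq_top_iff]
    rintro q -
    obtain ⟨s, rfl⟩ := Ideal.Quotient.mkₐ_surjective R (idealAt hι x) q
    have hs : s ∈ Algebra.adjoin R (Set.range ι) := hι.generates ▸ Algebra.mem_top
    suffices Algebra.adjoin R (Set.range ι) ≤
        (Algebra.ofId R (S ⧸ idealAt hι x)).range.comap (Ideal.Quotient.mkₐ R _) from this hs
    refine Algebra.adjoin_le ?_
    rintro _ ⟨a, rfl⟩
    change Ideal.Quotient.mkₐ R (idealAt hι x) (ι a) ∈ (Algebra.ofId R _).range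
    rcases x.2.mem_or_mem (show a * (1 + a) ∈ x.asIdeal by simp) with ha | ha
    · rw [show Ideal.Quotient.mkₐ R (idealAt hι x) (ι a) = 0 from
        Ideal.Quotient.eq_zero_iff_mem.2 (map_mem_idealAt hι ha)]
      exact zero_mem _
    · have h := map_mem_idealAt hι ha
      rw [hι.map_one_add] at h
      rw [show Ideal.Quotient.mkₐ R (idealAt hι x) (ι a) = 1 from
        (Ideal.Quotient.eq.2 h).symm]
      exact one_mem _

/-- The character of `S` at a prime `x` of the Boolean ring of idempotents: reduction modulo the
ideal at `x`, whose quotient is `R`. -/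
noncomputable def eval (x : PrimeSpectrum A) : S →ₐ[R] R :=
  ((AlgEquiv.ofBijective _ (bijective_algebraMap_quotient hι x)).symm :
    (S ⧸ idealAt hι x) →ₐ[R] R).comp (Ideal.Quotient.mkₐ R _)

lemma eval_eq_zero_iff (x : PrimeSpectrum A) (s : S) :
    eval hι x s = 0 ↔ s ∈ idealAt hι x := by
  rw [← Ideal.Quotient.eq_zero_iff_mem]
  exact EmbeddingLike.map_eq_zero_iff (f := (AlgEquiv.ofBijective _
    (bijective_algebraMap_quotient hι x)).symm)

lemma eval_of_mem {x : PrimeSpectrum A} {a : A} (ha : a ∈ x.asIdeal) :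
    eval hι x (ι a) = 0 :=
  (eval_eq_zero_iff ..).2 (map_mem_idealAt hι ha)

lemma eval_of_notMem {x : PrimeSpectrum A} {a : A} (ha : a ∉ x.asIdeal) :
    eval hι x (ι a) = 1 := by
  have h : 1 + a ∈ x.asIdeal :=
    (x.2.mem_or_mem (show a * (1 + a) ∈ x.asIdeal by simp)).resolve_left ha
  have h0 := eval_of_mem hι h
  rw [hι.map_one_add, map_sub, map_one] at h0
  exact (sub_eq_zero.1 h0).symm

lemma eval_map (x : PrimeSpectrum A) (a : A) :
    eval hι x (ι a) = LocallyConstant.charFn R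
      (PrimeSpectrum.isClopen_iff.2 ⟨a, BooleanRing.isIdempotentElem a, rfl⟩ :
        IsClopen (PrimeSpectrum.basicOpen a : Set (PrimeSpectrum A))) x := by
  by_cases hx : a ∈ x.asIdeal
  · simp [eval_of_mem hι hx, LocallyConstant.coe_charFn, hx]
  · simp [eval_of_notMem hι hx, LocallyConstant.coe_charFn, hx]

lemma isLocallyConstant_eval (s : S) :
    IsLocallyConstant fun x ↦ eval hι x s := by
  have hs : s ∈ Algebra.adjoin R (Set.range ι) := hι.generates ▸ Algebra.mem_top
  induction hs using Algebra.adjoin_induction with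
  | mem s hs =>
    obtain ⟨a, rfl⟩ := hs
    simp only [eval_map hι]
    exact LocallyConstant.isLocallyConstant _
  | algebraMap r =>
    simp only [AlgHom.commutes]
    exact IsLocallyConstant.const _
  | add s t _ _ hs ht =>
    simp only [map_add]
    exact hs.add ht
  | mul s t _ _ hs ht =>
    simp only [map_mul]
    exact hs.mul ht

/-- The transform of `S`, sending `s` to the function whose value at `x` is the image of `s` under
the character at `x`. -/
noncomputable def transform : S →ₐ[R] LocallyConstant (PrimeSpectrum A) R :=
  AlgHom.ofLinearMap
    { toFun := fun s ↦ ⟨_, isLocallyConstant_eval hι s⟩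
      map_add' := fun s t ↦ LocallyConstant.ext fun x ↦
        map_add (eval hι x) s t
      map_smul' := fun r s ↦ LocallyConstant.ext fun x ↦
        map_smul (eval hι x) r s }
    (LocallyConstant.ext fun x ↦ map_one (eval hι x))
    (fun s t ↦ LocallyConstant.ext fun x ↦ map_mul (eval hι x) s t)

lemma bijective_transform : Function.Bijective (transform hι) := by
  constructor
  · refine (injective_iff_map_eq_zero _).2 fun s hs ↦ ?_
    by_contra hne
    -- The elements of `A` annihilating `s` form a proper ideal; take a maximal ideal above it.
    let J : Ideal A :=
      { carrier := {a | s * ι a = 0}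
        zero_mem' := by simp
        add_mem' := by
          intro a b ha hb
          -- The symmetric difference `a + b` lies below the join of `a` and `b`.
          have h : (a + b) * (a + b + a * b) = a + b := by
            linear_combination (1 + b) * BooleanRing.mul_self a +
              (1 + a) * BooleanRing.mul_self b + 2 * BooleanRing.add_self (a * b)
          change s * ι a = 0 at ha
          change s * ι b = 0 at hb
          change s * ι (a + b) = 0
          rw [← h, map_mul]
          linear_combination ι (a + b) * (-s * hι.map_join a b + (1 - ι b) * ha + hb)
        smul_mem' := fun c a ha ↦ by
          change s * ι (c * a) = 0
          rw [map_mul, mul_left_comm, show s * ι a = 0 from ha, mul_zero] }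
    have hJ : J ≠ ⊤ := fun h ↦ hne <| by
      have h1 : (1 : A) ∈ J := h ▸ Submodule.mem_top
      simpa using (show s * ι 1 = 0 from h1)
    obtain ⟨M, hM, hJM⟩ := Ideal.exists_le_maximal J hJ
    obtain ⟨a, ha, hsa⟩ := (eval_eq_zero_iff hι ⟨M, hM.isPrime⟩ s).1
      congr($hs ⟨M, hM.isPrime⟩)
    rw [← hι.map_one_add] at hsa
    refine hM.ne_top ((Ideal.eq_top_iff_one M).2 ?_)
    exact (Ideal.add_mem_iff_left M ha).1 (hJM hsa)
  · rw [← AlgHom.range_eq_top, eq_top_iff]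
    rintro f -
    refine LocallyConstant.mem_of_charFn_mem _ (fun U hU ↦ ?_) f
    obtain ⟨a, -, rfl⟩ := PrimeSpectrum.isClopen_iff.1 hU
    exact ⟨ι a, LocallyConstant.ext fun x ↦ eval_map hι x a⟩

end

lemma isTopologicalBasis_isClopen_primeSpectrum (A : Type*) [BooleanRing A] :
    TopologicalSpace.IsTopologicalBasis {U : Set (PrimeSpectrum A) | IsClopen U} := by
  refine TopologicalSpace.isTopologicalBasis_of_isOpen_of_nhds (fun U hU ↦ hU.isOpen) ?_
  intro x U hx hU
  obtain ⟨_, ⟨a, rfl⟩, hxa, haU⟩ :=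
    PrimeSpectrum.isTopologicalBasis_basic_opens.exists_subset_of_mem_open hx hU
  exact ⟨_, PrimeSpectrum.isClopen_iff.2 ⟨a, BooleanRing.isIdempotentElem a, rfl⟩, hxa, haU⟩

lemma t2Space_primeSpectrum (A : Type*) [BooleanRing A] : T2Space (PrimeSpectrum A) := by
  have := totallySeparatedSpace_of_t0_of_basis_clopen (isTopologicalBasis_isClopen_primeSpectrum A)
  infer_instance

/-- The inclusion of a Boolean subalgebra of idempotents, on the associated Boolean ring; it
preserves products, though in general not sums. -/
def inclusion {S : Type*} [CommRing S] (B : BooleanSubalgebra (Idempotents S)) :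
    AsBoolRing B →*₀ S where
  toFun a := ((ofBoolRing a : B) : Idempotents S)
  map_zero' := rfl
  map_one' := rfl
  map_mul' _ _ := rfl

lemma inclusion_one_add {S : Type*} [CommRing S] (B : BooleanSubalgebra (Idempotents S))
    (a : AsBoolRing B) : inclusion B (1 + a) = 1 - inclusion B a := by
  have h : ofBoolRing (1 + a) = (ofBoolRing a)ᶜ := by
    rw [ofBoolRing_add, ofBoolRing_one, top_symmDiff, hnot_eq_compl]
  change (((ofBoolRing (1 + a) : B) : Idempotents S) : S) = _
  rw [h]
  rfl

end SpeckerRepresentation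

open SpeckerRepresentation in
/-- Every Specker algebra is the algebra of locally constant functions on the Stone space of any of
its faithful generating algebras of idempotents. -/
lemma IsSpeckerAlgebra.exists_algEquiv_locallyConstant {R : Type*} {S : Type v} [CommRing R]
    [CommRing S] [Algebra R S] (hS : IsSpeckerAlgebra R S) :
    ∃ X : StoneSpaceCat.{v}, Nonempty (S ≃ₐ[R] LocallyConstant X R) := by
  obtain ⟨B, hB⟩ := hS
  have : T2Space (PrimeSpectrum (AsBoolRing B)) := t2Space_primeSpectrum _
  have : CompHausLike.HasProp
      (fun X ↦ TopologicalSpace.IsTopologicalBasis {U : Set X | IsClopen U})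
      (PrimeSpectrum (AsBoolRing B)) :=
    ⟨isTopologicalBasis_isClopen_primeSpectrum _⟩
  refine ⟨CompHausLike.of _ (PrimeSpectrum (AsBoolRing B)), ⟨AlgEquiv.ofBijective
    (transform (ι := inclusion B) ⟨inclusion_one_add B, fun a ha ↦ ?_, fun a ↦ ?_, ?_⟩)
    (bijective_transform _)⟩⟩
  · exact Subtype.ext (Subtype.ext ha)
  · exact hB.faithful _ (ofBoolRing a).2
  · rw [← hB.generates]
    congr 1
    ext s
    constructor
    · rintro ⟨a, rfl⟩
      exact ⟨_, (ofBoolRing a).2, rfl⟩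
    · rintro ⟨e, he, rfl⟩
      exact ⟨toBoolRing ⟨e, he⟩, rfl⟩

/-! ### The equivalence of categories -/

namespace IsIndecomposableRing

variable {R : Type u} [CommRing R] (hR : IsIndecomposableRing R)

/-- The contravariant functor sending a Stone space to its Specker algebra of locally constant
`R`-valued functions. -/
def locallyConstantFunctor : StoneSpaceCat.{max u v}ᵒᵖ ⥤ SpeckerAlgCat.{u, max u v} R where
  obj X := ⟨CommAlgCat.of R (LocallyConstant X.unop R), hR.isSpeckerAlgebra_locallyConstant⟩
  map f := ObjectProperty.homMk (CommAlgCat.ofHom (LocallyConstant.comapₐ R f.unop.hom.hom))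

instance faithful_locallyConstantFunctor : (locallyConstantFunctor.{u, v} hR).Faithful where
  map_injective {X Y} f g h := by
    have := hR.nontrivial
    refine Quiver.Hom.unop_inj (ConcreteCategory.hom_ext _ _ fun y ↦ ?_)
    refine LocallyConstant.eq_of_forall_apply_eq (R := R) X.unop.prop fun a ↦ ?_
    have ha : LocallyConstant.comapₐ R f.unop.hom.hom a =
        LocallyConstant.comapₐ R g.unop.hom.hom a :=
      congr(($h).hom.hom a)
    exact congr($ha y)

instance full_locallyConstantFunctor : (locallyConstantFunctor.{u, v} hR).Full where
  map_surjective {X Y} φ := by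
    obtain ⟨g, hg⟩ := hR.exists_eq_comap X.unop.prop φ.hom.hom
    refine ⟨Quiver.Hom.op (ConcreteCategory.ofHom g), ?_⟩
    apply ObjectProperty.hom_ext
    apply CommAlgCat.hom_ext
    exact hg.symm

instance essSurj_locallyConstantFunctor : (locallyConstantFunctor.{u, v} hR).EssSurj where
  mem_essImage S := by
    obtain ⟨X, ⟨e⟩⟩ := S.property.exists_algEquiv_locallyConstant
    exact ⟨Opposite.op X, ⟨ObjectProperty.isoMk _ (CommAlgCat.isoMk e.symm)⟩⟩

end IsIndecomposableRing

/-- Algebras live in a universe containing that of `R`, since a nonzero Specker `R`-algebra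
contains a copy of `R`; the Stone spaces live in the same universe as the algebras. -/
theorem corollary3p7 (R : Type u) [CommRing R] (hR : IsIndecomposableRing R) :
    DuallyEquivalent (SpeckerAlgCat.{u, max u v} R) StoneSpaceCat.{max u v} := by
  have : (hR.locallyConstantFunctor.{u, v}).IsEquivalence := {}
  exact ⟨hR.locallyConstantFunctor.{u, v}.asEquivalence.symm.leftOp⟩
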